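/- Consider first-passage percolation on the nearest-neighbour lattice $\mathbf{Z}^2$: the edges carry i.i.d. exponential passage times of mean $1$, and for vertices $x,y$ let $T(x,y)$ be the infimum, over all finite lattice paths from $x$ to $y$, of the sum of the passage times of the edges along the path. For a unit vector $v=(v_1,v_2)\in\mathbf{R}^2$ and $n\ge 1$ let $v^{(n)}=(\lfloor nv_1\rfloor,\lfloor nv_2\rfloor)\in\mathbf{Z}^2$. There is an absolute constant $C>0$ such that for every unit vector $v$ the following two statements hold. (i) For every $n\ge 1$, the passage time $T(0,v^{(n)})$ is square-integrable and $\operatorname{Var}\bigl(T(0,v^{(n)})\bigr)\ge C\log n$. (ii) For all real sequences $(a_n)$, $(b_n)$ with $b_n-a_n=o\bigl((\log n)^{1/2}\bigr)$ as $n\to\infty$, one has $\mathbf{P}\bigl(T(0,v^{(n)})\in[a_n,b_n]\bigr)\to 0$ as $n\to\infty$. -/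

import Mathlib

open MeasureTheory ProbabilityTheory Filter Topology

noncomputable section

namespace FPP

/-- The square lattice `ℤ²`: two vertices are joined by an edge iff they are at
`ℓ¹`-distance one. -/
def lattice : SimpleGraph (ℤ × ℤ) where
  Adj x y := |x.1 - y.1| + |x.2 - y.2| = 1
  symm := ⟨fun x y h => by rwa [abs_sub_comm y.1, abs_sub_comm y.2]⟩
  loopless := ⟨fun x h => by simp at h⟩

/-- The (undirected) edges of `ℤ²`. -/
abbrev Edge : Type := lattice.edgeSet

/-- The total passage time of a finite lattice path, for edge passage times `w`. -/
def pathTime (w : Edge → ℝ) {x y : ℤ × ℤ} (p : lattice.Walk x y) : ℝ :=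
  (p.darts.map fun d => w ⟨d.edge, d.edge_mem⟩).sum

/-- The first-passage time `T(x, y)`: the infimum of the passage times of all finite
lattice paths from `x` to `y`. -/
def passageTime (w : Edge → ℝ) (x y : ℤ × ℤ) : ℝ :=
  ⨅ p : lattice.Walk x y, pathTime w p

/-- The lattice vertex whose coordinates are the integer parts of those of `n • v`. -/
def intPart (v : EuclideanSpace ℝ (Fin 2)) (n : ℕ) : ℤ × ℤ :=
  (⌊(n : ℝ) * v 0⌋, ⌊(n : ℝ) * v 1⌋)

end FPP

end

/-! The argument is a change of measure. Multiply the passage time of each edge `e` by `1 + κ * prof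
J e`, where `prof J e` is of the order of the inverse distance of `e` to the origin, cut off at the
dyadic scale `J`, with `J` about `log n`.

The rescaling is cheap. In the plane a dyadic annulus at scale `k` has `O(4 ^ k)` edges, each with
squared profile `4 ^ (-k)`, so the squares sum to `O(J)` (`sum_prof_sq_le`). Rescaled exponentials
are exponentials of another rate, and the χ²-distance to the original product law is at most `exp
(O(κ ^ 2 * J)) - 1` (`sq_integral_comp_scale_sub_le`).

The effect on the passage time is large. Every walk to the target crosses all `J` scales, and gains
order `κ` at each scale free of abnormally fast trails (`add_le_passageTime_perturb`). The expected
number of scales with such trails is bounded (`integral_fastCount_le`), so the typical gain has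
order `κ * J`.

For `κ` of order `1 / √J` the law moves by a bounded χ²-distance while the mean moves by order `√J`;
Cauchy–Schwarz then forces a variance of order `J`. For the second statement, `m` successive
rescalings each change the probability of an interval by at most `ε`, yet outside a rare event they
separate the passage times by more than the interval's length, so at most one of them lands in it.
-/

namespace FPP

/-! ### Rescaling exponential variables as a change of density. -/

section Tilting

open Measure
open scoped ENNReal

/-- The density of the exponential law of rate `r` with respect to the one of rate `1`. -/
noncomputable def expTilt (r x : ℝ) : ℝ := r * Real.exp ((1 - r) * x)

lemma expTilt_nonneg {r : ℝ} (hr : 0 < r) (x : ℝ) : 0 ≤ expTilt r x :=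
  mul_nonneg hr.le (Real.exp_pos _).le

@[fun_prop]
lemma measurable_expTilt (r : ℝ) : Measurable (expTilt r) := by
  unfold expTilt; fun_prop

lemma expMeasure_eq_withDensity (r : ℝ) :
    expMeasure r = (expMeasure 1).withDensity (fun x => ENNReal.ofReal (expTilt r x)) := by
  have h (r : ℝ) : expMeasure r = volume.withDensity (exponentialPDF r) := rfl
  have hm (r : ℝ) : Measurable (exponentialPDF r) :=
    (measurable_exponentialPDFReal r).ennreal_ofReal
  rw [h, h, ← withDensity_mul _ (hm 1) (by fun_prop)]
  congr 1
  funext x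
  simp only [Pi.mul_apply, exponentialPDF_eq]
  split_ifs
  · rw [← ENNReal.ofReal_mul (by positivity)]
    congr 1
    rw [expTilt, mul_left_comm, one_mul, ← Real.exp_add]
    ring_nf
  · simp

lemma lintegral_expTilt {r : ℝ} (hr : 0 < r) :
    ∫⁻ x, ENNReal.ofReal (expTilt r x) ∂(expMeasure 1) = 1 := by
  have := isProbabilityMeasure_expMeasure hr
  have h := congrArg (fun μ : Measure ℝ => μ Set.univ) (expMeasure_eq_withDensity r)
  simpa using h.symm

/-- This is the total mass of the exponential law of rate `1 - s`, read through its density, so no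
integral has to be computed. -/
lemma lintegral_exp_mul_expMeasure {s : ℝ} (hs : s < 1) :
    ∫⁻ x, ENNReal.ofReal (Real.exp (s * x)) ∂(expMeasure 1) = ENNReal.ofReal (1 - s)⁻¹ := by
  have h := lintegral_expTilt (r := 1 - s) (by linarith)
  have h1 : 0 < 1 - s := by linarith
  simp only [expTilt, sub_sub_cancel] at h
  simp_rw [ENNReal.ofReal_mul h1.le] at h
  rw [lintegral_const_mul _ (by fun_prop)] at h
  rw [ENNReal.ofReal_inv_of_pos h1]
  exact ENNReal.eq_inv_of_mul_eq_one_left (by rwa [mul_comm])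

/-- The squared density grows with exponent `2 * (1 - r)`, which must stay below `1`; hence the
bound on `r`. -/
lemma lintegral_expTilt_sq {r : ℝ} (hr : 1 / 2 < r) :
    ∫⁻ x, ENNReal.ofReal (expTilt r x ^ 2) ∂(expMeasure 1) =
      ENNReal.ofReal (r ^ 2 / (2 * r - 1)) := by
  have h (x : ℝ) : expTilt r x ^ 2 = r ^ 2 * Real.exp ((2 * (1 - r)) * x) := by
    rw [expTilt, mul_pow, ← Real.exp_nat_mul]; push_cast; ring_nf
  simp_rw [h, ENNReal.ofReal_mul (sq_nonneg r)]
  rw [lintegral_const_mul _ (by fun_prop), lintegral_exp_mul_expMeasure (by linarith),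
    ← ENNReal.ofReal_mul (sq_nonneg r), div_eq_mul_inv]
  ring_nf

lemma map_mul_expMeasure {r : ℝ} (hr : 0 < r) :
    (expMeasure 1).map (fun x => r⁻¹ * x) = expMeasure r := by
  have := isProbabilityMeasure_expMeasure hr
  have := isProbabilityMeasure_expMeasure one_pos
  have : IsProbabilityMeasure ((expMeasure 1).map (fun x => r⁻¹ * x)) :=
    isProbabilityMeasure_map (by fun_prop)
  apply eq_of_cdf
  ext x
  have h : (fun x => r⁻¹ * x) ⁻¹' Set.Iic x = Set.Iic (r * x) := by
    ext y
    simp only [Set.mem_preimage, Set.mem_Iic]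
    rw [inv_mul_le_iff₀ hr]
  rw [cdf_eq_real, map_measureReal_apply (by fun_prop) measurableSet_Iic, h, ← cdf_eq_real,
    cdf_expMeasure_eq one_pos, cdf_expMeasure_eq hr]
  simp [mul_nonneg_iff_of_pos_left hr]

variable {ι : Type*}

/-- The law of i.i.d. exponential variables of mean one. -/
noncomputable def expProd (ι : Type*) : Measure (ι → ℝ) := infinitePi fun _ : ι => expMeasure 1

instance : IsProbabilityMeasure (expMeasure 1) := isProbabilityMeasure_expMeasure one_pos

instance : IsProbabilityMeasure (expProd ι) := by unfold expProd; infer_instance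

lemma lintegral_infinitePi_prod {μ : ι → Measure ℝ} [∀ i, IsProbabilityMeasure (μ i)]
    (s : Finset ι) {g : ι → ℝ → ℝ≥0∞} (hg : ∀ i, Measurable (g i)) :
    ∫⁻ ω, ∏ i ∈ s, g i (ω i) ∂(infinitePi μ) = ∏ i ∈ s, ∫⁻ x, g i x ∂(μ i) := by
  rw [lintegral_prod_eq_prod_lintegral_of_indepFun s (fun i (ω : ι → ℝ) => g i (ω i))
    (iIndepFun_infinitePi hg) (fun i => by fun_prop)]
  refine Finset.prod_congr rfl fun i _ => ?_
  rw [← infinitePi_map_eval μ i, lintegral_map (hg i) (by fun_prop)]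

/-- The density of a product of exponential laws of rates `r i`, `i ∈ F`. -/
noncomputable def expTiltProd (F : Finset ι) (r : ι → ℝ) (ω : ι → ℝ) : ℝ :=
  ∏ i ∈ F, expTilt (r i) (ω i)

@[fun_prop]
lemma measurable_expTiltProd (F : Finset ι) (r : ι → ℝ) : Measurable (expTiltProd F r) := by
  unfold expTiltProd; fun_prop

lemma expTiltProd_nonneg (F : Finset ι) {r : ι → ℝ} (hr : ∀ i, 0 < r i) (ω : ι → ℝ) :
    0 ≤ expTiltProd F r ω := Finset.prod_nonneg fun i _ => expTilt_nonneg (hr i) _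

/-- A product measure is determined by finite boxes. On a box over `s` the integrand factors over `s
∪ F`, and the coordinates outside `s` integrate to one. -/
lemma expProd_withDensity (F : Finset ι) {r : ι → ℝ} (hr : ∀ i, 0 < r i)
    (hF : ∀ i ∉ F, r i = 1) :
    (expProd ι).withDensity (fun ω => ENNReal.ofReal (expTiltProd F r ω)) =
      infinitePi fun i => expMeasure (r i) := by
  classical
  have _ i := isProbabilityMeasure_expMeasure (hr i)
  refine eq_infinitePi _ fun s t ht => ?_
  have hms : MeasurableSet (Set.pi (s : Set ι) t) := .pi s.countable_toSet fun i _ => ht i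
  let g : ι → ℝ → ℝ≥0∞ := fun i x =>
    (if i ∈ s then (t i).indicator 1 x else 1) *
      (if i ∈ F then ENNReal.ofReal (expTilt (r i) x) else 1)
  have hg i : Measurable (g i) := by
    refine Measurable.mul ?_ ?_
    · split_ifs
      · exact measurable_one.indicator (ht i)
      · fun_prop
    · split_ifs <;> fun_prop
  have hgF i : g i = fun x => (if i ∈ s then (t i).indicator 1 x else 1) *
      ENNReal.ofReal (expTilt (r i) x) := by
    funext x
    simp only [g]
    by_cases h : i ∈ F
    · simp [h]
    · simp [h, expTilt, hF i h]
  have hint (ω : ι → ℝ) : (Set.pi (s : Set ι) t).indicator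
      (fun ω => ENNReal.ofReal (expTiltProd F r ω)) ω = ∏ i ∈ s ∪ F, g i (ω i) := by
    simp only [g, Finset.prod_mul_distrib]
    have h1 : ∏ i ∈ s ∪ F, (if i ∈ F then ENNReal.ofReal (expTilt (r i) (ω i)) else 1) =
        ENNReal.ofReal (expTiltProd F r ω) := by
      rw [Finset.prod_ite_mem, Finset.union_inter_cancel_right, expTiltProd,
        ENNReal.ofReal_prod_of_nonneg fun i _ => expTilt_nonneg (hr i) _]
    rw [h1, Finset.prod_ite_mem, Finset.union_inter_cancel_left]
    by_cases h : ω ∈ Set.pi (s : Set ι) t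
    · rw [Set.indicator_of_mem h, Finset.prod_eq_one, one_mul]
      intro i hi
      simp [h i hi]
    · rw [Set.indicator_of_notMem h]
      obtain ⟨i, hi, hti⟩ : ∃ i ∈ s, ω i ∉ t i := by simpa [Set.mem_pi] using h
      rw [Finset.prod_eq_zero hi (by simp [hti]), zero_mul]
  rw [withDensity_apply _ hms, ← lintegral_indicator hms]
  simp_rw [hint]
  rw [expProd, lintegral_infinitePi_prod _ hg, ← Finset.prod_subset Finset.subset_union_left]
  · refine Finset.prod_congr rfl fun i hi => ?_
    rw [expMeasure_eq_withDensity (r i), withDensity_apply _ (ht i),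
      ← lintegral_indicator (ht i), hgF]
    congr 1
    funext x
    by_cases hx : x ∈ t i <;> simp [hi, hx]
  · intro i _ hi
    rw [hgF]
    simpa [hi] using lintegral_expTilt (hr i)

lemma map_scale_expProd {r : ι → ℝ} (hr : ∀ i, 0 < r i) :
    (expProd ι).map (fun ω i => (r i)⁻¹ * ω i) = infinitePi fun i => expMeasure (r i) := by
  rw [expProd, infinitePi_map_pi (f := fun i x => (r i)⁻¹ * x) _ (fun i => by fun_prop)]
  simp_rw [fun i => map_mul_expMeasure (hr i)]

lemma integral_comp_scale (F : Finset ι) {r : ι → ℝ} (hr : ∀ i, 0 < r i)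
    (hF : ∀ i ∉ F, r i = 1) {f : (ι → ℝ) → ℝ} (hf : Measurable f) :
    ∫ ω, f (fun i => (r i)⁻¹ * ω i) ∂(expProd ι) =
      ∫ ω, expTiltProd F r ω * f ω ∂(expProd ι) := by
  rw [← integral_map (φ := fun (ω : ι → ℝ) i => (r i)⁻¹ * ω i)
      (measurable_pi_lambda _ fun i => by fun_prop).aemeasurable hf.aestronglyMeasurable,
    map_scale_expProd hr, ← expProd_withDensity F hr hF,
    integral_withDensity_eq_integral_toReal_smul (by fun_prop) (by simp)]
  simp [ENNReal.toReal_ofReal (expTiltProd_nonneg F hr _)]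

lemma lintegral_expTiltProd_sq (F : Finset ι) {r : ι → ℝ} (hr : ∀ i, 1 / 2 < r i) :
    ∫⁻ ω, ENNReal.ofReal (expTiltProd F r ω ^ 2) ∂(expProd ι) =
      ENNReal.ofReal (∏ i ∈ F, r i ^ 2 / (2 * r i - 1)) := by
  simp_rw [expTiltProd, ← Finset.prod_pow]
  rw [ENNReal.ofReal_prod_of_nonneg
    fun i _ => div_nonneg (sq_nonneg _) (by linarith [hr i])]
  simp_rw [ENNReal.ofReal_prod_of_nonneg fun i _ => sq_nonneg (expTilt (r i) _)]
  rw [expProd, lintegral_infinitePi_prod F (g := fun i x => ENNReal.ofReal (expTilt (r i) x ^ 2))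
    (fun i => by fun_prop)]
  exact Finset.prod_congr rfl fun i _ => lintegral_expTilt_sq (hr i)

lemma memLp_expTiltProd (F : Finset ι) {r : ι → ℝ} (hr : ∀ i, 1 / 2 < r i) :
    MemLp (expTiltProd F r) 2 (expProd ι) := by
  rw [memLp_two_iff_integrable_sq (by fun_prop)]
  refine ⟨by fun_prop, ?_⟩
  rw [hasFiniteIntegral_iff_ofReal (ae_of_all _ fun ω => sq_nonneg _),
    lintegral_expTiltProd_sq F hr]
  exact ENNReal.ofReal_lt_top

lemma integral_expTiltProd_sq (F : Finset ι) {r : ι → ℝ} (hr : ∀ i, 1 / 2 < r i) :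
    ∫ ω, expTiltProd F r ω ^ 2 ∂(expProd ι) = ∏ i ∈ F, r i ^ 2 / (2 * r i - 1) := by
  rw [integral_eq_lintegral_of_nonneg_ae (ae_of_all _ fun ω => sq_nonneg _) (by fun_prop),
    lintegral_expTiltProd_sq F hr, ENNReal.toReal_ofReal]
  exact Finset.prod_nonneg fun i _ => div_nonneg (sq_nonneg _) (by linarith [hr i])

/-- The variance of `t • X + Y` is a nonnegative quadratic in `t`, so its discriminant is
nonpositive. -/
lemma sq_covariance_le {Ω : Type*} [MeasurableSpace Ω] {μ : Measure Ω} [IsProbabilityMeasure μ]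
    {X Y : Ω → ℝ} (hX : MemLp X 2 μ) (hY : MemLp Y 2 μ) :
    covariance X Y μ ^ 2 ≤ variance X μ * variance Y μ := by
  have h (t : ℝ) : 0 ≤ variance X μ * (t * t) + 2 * covariance X Y μ * t + variance Y μ := by
    have h1 := variance_nonneg (t • X + Y) μ
    rw [variance_add (hX.const_smul t) hY, variance_smul, covariance_smul_left] at h1
    linarith
  have := discrim_le_zero h
  rw [discrim] at this
  linarith

/-- Rescaling finitely many coordinates changes the mean of `f` by at most the `χ²`-distance
times the standard deviation of `f`. -/
lemma sq_integral_comp_scale_sub_le (F : Finset ι) {η : ι → ℝ} (h0 : ∀ i, 0 ≤ η i)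
    (h1 : ∀ i, η i ≤ 1 / 4) (hF : ∀ i ∉ F, η i = 0) {f : (ι → ℝ) → ℝ} (hf : Measurable f)
    (hf2 : MemLp f 2 (expProd ι)) :
    (∫ ω, f (fun i => (1 + η i) * ω i) ∂(expProd ι) - ∫ ω, f ω ∂(expProd ι)) ^ 2 ≤
      (Real.exp (2 * ∑ i ∈ F, η i ^ 2) - 1) * variance f (expProd ι) := by
  set r : ι → ℝ := fun i => (1 + η i)⁻¹ with hr
  have hpos i : 0 < 1 + η i := by linarith [h0 i]
  have hr0 i : 0 < r i := inv_pos.2 (hpos i)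
  have hrh i : 1 / 2 < r i := by
    rw [hr, one_div]; exact (inv_lt_inv₀ two_pos (hpos i)).2 (by linarith [h1 i])
  have hrF i (hi : i ∉ F) : r i = 1 := by simp [hr, hF i hi]
  have e1 := integral_comp_scale F hr0 hrF hf
  have e2 := integral_comp_scale F hr0 hrF (f := fun _ => (1 : ℝ)) (by fun_prop)
  simp only [hr, inv_inv] at e1
  have e3 : ∫ ω, expTiltProd F r ω ∂(expProd ι) = 1 := by simpa using e2.symm
  have hL := memLp_expTiltProd F hrh
  -- The density has mean one, so the shift in the mean of `f` is its covariance with the density.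
  have hc := sq_covariance_le hL hf2
  rw [covariance_eq_sub hL hf2, e3, one_mul] at hc
  rw [e1]
  refine hc.trans (mul_le_mul_of_nonneg_right ?_ (variance_nonneg _ _))
  rw [variance_eq_sub hL, e3]
  have e4 := integral_expTiltProd_sq F hrh
  simp only [Pi.pow_apply]
  rw [e4, one_pow, Finset.mul_sum, Real.exp_sum]
  refine sub_le_sub_right (Finset.prod_le_prod
    (fun i _ => div_nonneg (sq_nonneg _) (by linarith [hrh i])) fun i _ => ?_) _
  have hη : η i ^ 2 ≤ 1 / 16 := by nlinarith [h0 i, h1 i]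
  have e5 : r i ^ 2 / (2 * r i - 1) = (1 - η i ^ 2)⁻¹ := by
    have h3 : 1 - η i ≠ 0 := by linarith [h1 i]
    have h4 : 1 - η i ^ 2 ≠ 0 := by linarith
    have h5 : 2 * r i - 1 = (1 - η i) / (1 + η i) := by
      simp only [hr]; field_simp [(hpos i).ne']; ring
    rw [h5]; simp only [hr]; field_simp [(hpos i).ne']; ring
  rw [e5]
  -- Each coordinate contributes `(1 - η ^ 2)⁻¹ ≤ 1 + 2 * η ^ 2`, valid because `η ^ 2 ≤ 1 / 16`.
  refine le_trans ?_ (Real.add_one_le_exp _)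
  rw [inv_le_iff_one_le_mul₀ (by linarith)]
  nlinarith [sq_nonneg (η i)]

end Tilting

end FPP

namespace FPP

/-! ### Edges by dyadic scale, and the perturbation profile. -/

section Lattice

/-- The `ℓ¹`-norm of a lattice vertex. -/
def nrm (x : ℤ × ℤ) : ℕ := x.1.natAbs + x.2.natAbs

lemma nrm_le_of_adj {x y : ℤ × ℤ} (h : lattice.Adj x y) : nrm y ≤ nrm x + 1 := by
  have h : |x.1 - y.1| + |x.2 - y.2| = 1 := h
  rw [Int.abs_eq_natAbs, Int.abs_eq_natAbs] at h
  unfold nrm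
  omega

/-- The four unit steps of the lattice. -/
def step : Fin 4 → ℤ × ℤ := ![(1, 0), (-1, 0), (0, 1), (0, -1)]

lemma adj_add_step (x : ℤ × ℤ) (i : Fin 4) : lattice.Adj x (x + step i) := by
  change |x.1 - (x + step i).1| + |x.2 - (x + step i).2| = 1
  fin_cases i <;> simp [step]

lemma exists_step_of_adj {x y : ℤ × ℤ} (h : lattice.Adj x y) : ∃ i, y = x + step i := by
  have h : |x.1 - y.1| + |x.2 - y.2| = 1 := h
  obtain ⟨a, b⟩ := x
  obtain ⟨c, d⟩ := y
  simp only [Int.abs_eq_natAbs] at h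
  have : (c = a + 1 ∧ d = b) ∨ (c = a - 1 ∧ d = b) ∨ (c = a ∧ d = b + 1) ∨
      (c = a ∧ d = b - 1) := by omega
  rcases this with ⟨rfl, rfl⟩ | ⟨rfl, rfl⟩ | ⟨rfl, rfl⟩ | ⟨rfl, rfl⟩
  · exact ⟨0, by simp [step]⟩
  · exact ⟨1, by simp [step, sub_eq_add_neg]⟩
  · exact ⟨2, by simp [step]⟩
  · exact ⟨3, by simp [step, sub_eq_add_neg]⟩

/-- The edge leaving `x` in direction `i`. -/
def edgeFrom (x : ℤ × ℤ) (i : Fin 4) : Edge := ⟨s(x, x + step i), adj_add_step x i⟩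

/-- The sum of the norms of the two endpoints of an edge. -/
def edgeNrm (e : Edge) : ℕ :=
  Sym2.lift ⟨fun x y => nrm x + nrm y, fun x y => add_comm (nrm x) (nrm y)⟩ e.1

lemma exists_eq_edgeFrom (e : Edge) : ∃ x i, e = edgeFrom x i ∧ nrm x ≤ edgeNrm e := by
  obtain ⟨e, he⟩ := e
  induction e using Sym2.ind with
  | _ x y =>
    obtain ⟨i, rfl⟩ := exists_step_of_adj (show lattice.Adj x y from he)
    exact ⟨x, i, rfl, by simp [edgeNrm]⟩

instance : Countable Edge := inferInstanceAs (Countable (lattice.edgeSet))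

/-- The dyadic scale of the distance of an edge to the origin. -/
def edgeScale (e : Edge) : ℕ := Nat.log 2 (edgeNrm e + 1)

/-- The box of radius `m` around the origin. -/
noncomputable def box (m : ℕ) : Finset (ℤ × ℤ) := Finset.Icc (-m : ℤ) m ×ˢ Finset.Icc (-m : ℤ) m

lemma mem_box_of_nrm_le {x : ℤ × ℤ} {m : ℕ} (h : nrm x ≤ m) : x ∈ box m := by
  unfold nrm at h
  simp only [box, Finset.mem_product, Finset.mem_Icc]
  omega

lemma card_box (m : ℕ) : (box m).card = (2 * m + 1) ^ 2 := by
  rw [box, Finset.card_product, Int.card_Icc, sq]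
  congr 1 <;> omega

/-- The edges leaving a vertex of the box of radius `2 ^ (k + 1)`. -/
noncomputable def edgeBox (k : ℕ) : Finset Edge :=
  (box (2 ^ (k + 1)) ×ˢ Finset.univ).image fun q : (ℤ × ℤ) × Fin 4 => edgeFrom q.1 q.2

lemma card_edgeBox_le (k : ℕ) : (edgeBox k).card ≤ 100 * 4 ^ k := by
  refine Finset.card_image_le.trans ?_
  rw [Finset.card_product, card_box, Finset.card_univ, Fintype.card_fin]
  have h : 1 ≤ 2 ^ k := Nat.one_le_two_pow
  have h4 : 4 ^ k = 2 ^ k * 2 ^ k := by rw [← mul_pow]; rfl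
  rw [h4, pow_succ (2 : ℕ) k]
  nlinarith

lemma mem_edgeBox {e : Edge} {k : ℕ} (h : edgeScale e ≤ k) : e ∈ edgeBox k := by
  obtain ⟨x, i, rfl, hx⟩ := exists_eq_edgeFrom e
  have h1 : edgeNrm (edgeFrom x i) + 1 < 2 ^ (k + 1) :=
    Nat.lt_pow_of_log_lt one_lt_two (Nat.lt_succ_of_le h)
  refine Finset.mem_image.2 ⟨(x, i), ?_, rfl⟩
  simp only [Finset.mem_product, Finset.mem_univ, and_true]
  exact mem_box_of_nrm_le (by omega)

/-- The perturbation profile: it decays like the inverse distance to the origin,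
up to scale `J`. -/
noncomputable def prof (J : ℕ) (e : Edge) : ℝ :=
  if edgeScale e ≤ J then (1 / 2) ^ edgeScale e else 0

lemma prof_nonneg (J : ℕ) (e : Edge) : 0 ≤ prof J e := by
  unfold prof; split_ifs <;> positivity

lemma prof_le_one (J : ℕ) (e : Edge) : prof J e ≤ 1 := by
  unfold prof
  split_ifs
  · exact pow_le_one₀ (by norm_num) (by norm_num)
  · exact zero_le_one

lemma prof_eq_zero {J : ℕ} {e : Edge} (h : e ∉ edgeBox J) : prof J e = 0 :=
  if_neg fun h' => h (mem_edgeBox h')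

/-- Dimension two enters here: the number of edges at scale `k` is compensated exactly by the
squared profile `4 ^ (-k)`, so each scale costs at most a constant. -/
lemma sum_prof_sq_le (J : ℕ) : ∑ e ∈ edgeBox J, prof J e ^ 2 ≤ 100 * (J + 1) := by
  calc ∑ e ∈ edgeBox J, prof J e ^ 2
      = ∑ e ∈ (edgeBox J).filter (fun e => edgeScale e ≤ J), (1 / 4 : ℝ) ^ edgeScale e := by
        rw [Finset.sum_filter]
        refine Finset.sum_congr rfl fun e _ => ?_
        unfold prof
        split_ifs
        · rw [← pow_mul, mul_comm, pow_mul]; norm_num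
        · simp
    _ = ∑ k ∈ Finset.range (J + 1), ∑ e ∈ ((edgeBox J).filter (fun e => edgeScale e ≤ J)).filter
          (fun e => edgeScale e = k), (1 / 4 : ℝ) ^ edgeScale e := by
        rw [Finset.sum_fiberwise_of_maps_to]
        intro e he
        simpa [Nat.lt_succ_iff] using (Finset.mem_filter.1 he).2
    _ ≤ ∑ k ∈ Finset.range (J + 1), (100 : ℝ) := by
        refine Finset.sum_le_sum fun k _ => ?_
        rw [Finset.sum_congr rfl (g := fun _ => (1 / 4 : ℝ) ^ k)
          fun e he => by rw [(Finset.mem_filter.1 he).2], Finset.sum_const, nsmul_eq_mul]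
        have h1 : (((edgeBox J).filter (fun e => edgeScale e ≤ J)).filter
            (fun e => edgeScale e = k)).card ≤ 100 * 4 ^ k :=
          (Finset.card_le_card fun e he => mem_edgeBox (Finset.mem_filter.1 he).2.le).trans
            (card_edgeBox_le k)
        have h2 : ((((edgeBox J).filter (fun e => edgeScale e ≤ J)).filter
            (fun e => edgeScale e = k)).card : ℝ) ≤ 100 * 4 ^ k := by exact_mod_cast h1
        calc _ ≤ 100 * 4 ^ k * (1 / 4 : ℝ) ^ k := by gcongr
          _ = 100 := by rw [mul_assoc, ← mul_pow]; norm_num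
    _ = 100 * (J + 1) := by simp; ring

end Lattice

/-! ### Deterministic gain of a walk under the perturbation. -/

section Walks

/-- The list of edges of a walk. -/
def edgeList {x y : ℤ × ℤ} (p : lattice.Walk x y) : List Edge :=
  p.darts.map fun d => ⟨d.edge, d.edge_mem⟩

lemma pathTime_eq (w : Edge → ℝ) {x y : ℤ × ℤ} (p : lattice.Walk x y) :
    pathTime w p = ((edgeList p).map w).sum := by
  simp [pathTime, edgeList, Function.comp_def]

lemma map_val_edgeList {x y : ℤ × ℤ} (p : lattice.Walk x y) :
    (edgeList p).map Subtype.val = p.edges := by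
  simp [edgeList, SimpleGraph.Walk.edges, Function.comp_def]

lemma nodup_edgeList {x y : ℤ × ℤ} {p : lattice.Walk x y} (hp : p.IsPath) :
    (edgeList p).Nodup := by
  apply List.Nodup.of_map Subtype.val
  rw [map_val_edgeList]
  exact hp.isTrail.edges_nodup

lemma nrm_le_add_length {x y : ℤ × ℤ} (p : lattice.Walk x y) : nrm y ≤ nrm x + p.length := by
  induction p with
  | nil => simp
  | cons h p ih =>
    have := nrm_le_of_adj h
    simp only [SimpleGraph.Walk.length_cons]
    omega

lemma edgeNrm_lt_of_mem {x y : ℤ × ℤ} (p : lattice.Walk x y) {e : Edge} (he : e ∈ edgeList p) :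
    edgeNrm e + 1 ≤ 2 * (nrm x + p.length) := by
  induction p with
  | nil => simp [edgeList] at he
  | cons h p ih =>
    have h1 := nrm_le_of_adj h
    simp only [edgeList, SimpleGraph.Walk.darts_cons, List.map_cons, List.mem_cons] at he
    simp only [SimpleGraph.Walk.length_cons]
    rcases he with rfl | he
    · simp only [edgeNrm, SimpleGraph.Dart.edge, Sym2.lift_mk]
      simp
      omega
    · have := ih he
      omega

/-- The edge lists of the walks of length `m` from `x`. -/
def edgeLists : ℕ → ℤ × ℤ → Finset (List Edge)
  | 0, _ => {[]}
  | m + 1, x => Finset.univ.biUnion fun i =>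
      (edgeLists m (x + step i)).image (List.cons (edgeFrom x i))

lemma card_edgeLists_le (m : ℕ) (x : ℤ × ℤ) : (edgeLists m x).card ≤ 4 ^ m := by
  induction m generalizing x with
  | zero => simp [edgeLists]
  | succ m ih =>
    refine Finset.card_biUnion_le.trans ?_
    refine (Finset.sum_le_sum fun i _ => Finset.card_image_le.trans (ih (x + step i))).trans ?_
    simp [pow_succ, mul_comm]

lemma edgeList_mem_edgeLists {x y : ℤ × ℤ} (p : lattice.Walk x y) :
    edgeList p ∈ edgeLists p.length x := by
  induction p with
  | nil => simp [edgeList, edgeLists]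
  | cons h p ih =>
    obtain ⟨i, rfl⟩ := exists_step_of_adj h
    simp only [SimpleGraph.Walk.length_cons, edgeLists, Finset.mem_biUnion, Finset.mem_univ,
      true_and, Finset.mem_image]
    exact ⟨i, _, ih, rfl⟩

lemma length_of_mem_edgeLists {m : ℕ} {x : ℤ × ℤ} {l : List Edge} (h : l ∈ edgeLists m x) :
    l.length = m := by
  induction m generalizing x l with
  | zero => simp_all [edgeLists]
  | succ m ih =>
    simp only [edgeLists, Finset.mem_biUnion, Finset.mem_univ, true_and, Finset.mem_image] at h
    obtain ⟨i, l, hl, rfl⟩ := h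
    simp [ih hl]

/-- The configurations for which some trail of length `2 ^ j` started within distance `2 ^ j` of
the origin is exceptionally fast. -/
def fastSet (j : ℕ) : Set (Edge → ℝ) :=
  ⋃ x ∈ box (2 ^ j), ⋃ l ∈ (edgeLists (2 ^ j) x).filter List.Nodup,
    {w | (l.map w).sum ≤ 1 / 1200 * 2 ^ j}

lemma measurable_sum_map (l : List Edge) : Measurable fun w : Edge → ℝ => (l.map w).sum := by
  induction l with
  | nil => simp
  | cons e l ih =>
    simp only [List.map_cons, List.sum_cons]
    fun_prop

lemma measurableSet_fastSet (j : ℕ) : MeasurableSet (fastSet j) :=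
  Finset.measurableSet_biUnion _ fun _ _ => Finset.measurableSet_biUnion _ fun l _ =>
    measurableSet_le (measurable_sum_map l) measurable_const

/-- The number of scales below `J` that contain a fast trail. -/
noncomputable def fastCount (J : ℕ) (w : Edge → ℝ) : ℝ :=
  ∑ j ∈ Finset.range J, (fastSet j).indicator 1 w

/-- The edges met have scale at most `j + 1`, hence profile at least `2 ^ (-(j + 1))`; a segment
that is not fast takes time at least `2 ^ j / 1200`. The product does not depend on `j`. If there is
a fast trail, only nonnegativity is claimed. -/
lemma le_pathTime_segment {J j : ℕ} (hj : j < J) {w : Edge → ℝ} (hw : ∀ e, 0 ≤ w e)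
    {x y : ℤ × ℤ} (hx : nrm x + 1 ≤ 2 ^ j) (p : lattice.Walk x y) (hp : p.IsPath)
    (hl : p.length = 2 ^ j) :
    1 / 2400 * (1 - (fastSet j).indicator 1 w) ≤ pathTime (fun e => prof J e * w e) p := by
  have hpos : 0 ≤ pathTime (fun e => prof J e * w e) p := by
    rw [pathTime_eq]
    refine List.sum_nonneg fun a ha => ?_
    obtain ⟨e, -, rfl⟩ := List.mem_map.1 ha
    exact mul_nonneg (prof_nonneg J e) (hw e)
  by_cases h : w ∈ fastSet j
  · simpa [h] using hpos
  · have h1 : 1 / 1200 * 2 ^ j ≤ ((edgeList p).map w).sum := by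
      by_contra! h2
      refine h ?_
      simp only [fastSet, Set.mem_iUnion]
      exact ⟨x, mem_box_of_nrm_le (by omega), edgeList p, Finset.mem_filter.2
        ⟨hl ▸ edgeList_mem_edgeLists p, nodup_edgeList hp⟩, h2.le⟩
    have h2 : (1 / 2 : ℝ) ^ (j + 1) * ((edgeList p).map w).sum ≤
        pathTime (fun e => prof J e * w e) p := by
      rw [pathTime_eq, ← List.sum_map_mul_left]
      refine List.sum_le_sum fun e he => mul_le_mul_of_nonneg_right ?_ (hw e)
      have h3 := edgeNrm_lt_of_mem p he
      have h4 : edgeScale e ≤ j + 1 := by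
        refine Nat.le_of_lt_succ (Nat.log_lt_of_lt_pow (by omega) ?_)
        rw [hl] at h3
        rw [pow_succ, pow_succ]
        omega
      -- Since `j < J`, scale `j + 1` is still within the cutoff.
      rw [prof, if_pos (by omega)]
      exact pow_le_pow_of_le_one (by norm_num) (by norm_num) h4
    rw [Set.indicator_of_notMem h]
    calc (1 / 2400 * (1 - 0) : ℝ) = (1 / 2) ^ (j + 1) * (1 / 1200 * 2 ^ j) := by
          rw [pow_succ, one_div_pow]; field_simp; norm_num
      _ ≤ _ := (mul_le_mul_of_nonneg_left h1 (by positivity)).trans h2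

/-- The first `2 ^ k - 1` steps split into blocks of lengths `1, 2, 4, …, 2 ^ (k - 1)`. Block `j`
starts after `2 ^ j - 1` steps, thus close enough to the origin for the segment bound. -/
lemma le_pathTime_take {J k : ℕ} (hk : k ≤ J) {w : Edge → ℝ} (hw : ∀ e, 0 ≤ w e)
    {y : ℤ × ℤ} (p : lattice.Walk (0, 0) y) (hp : p.IsPath) (hl : 2 ^ k ≤ p.length + 1) :
    1 / 2400 * (k - fastCount k w) ≤
      pathTime (fun e => prof J e * w e) (p.take (2 ^ k - 1)) := by
  induction k with
  | zero => simp [fastCount, pathTime]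
  | succ k ih =>
    have h2 : 2 ^ (k + 1) = 2 ^ k + 2 ^ k := by ring
    have h1 : 1 ≤ 2 ^ k := Nat.one_le_two_pow
    have h3 := ih (by omega) (by omega)
    have hx : nrm (p.getVert (2 ^ k - 1)) + 1 ≤ 2 ^ k := by
      have := nrm_le_add_length (p.take (2 ^ k - 1))
      rw [SimpleGraph.Walk.take_length] at this
      have h0 : nrm (0, 0) = 0 := rfl
      omega
    have h4 := le_pathTime_segment (J := J) (by omega) hw hx ((p.drop (2 ^ k - 1)).take (2 ^ k))
      ((hp.drop _).take _) (by
        rw [SimpleGraph.Walk.take_length, SimpleGraph.Walk.drop_length]; omega)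
    have h5 : pathTime (fun e => prof J e * w e) (p.take (2 ^ (k + 1) - 1)) =
        pathTime (fun e => prof J e * w e) (p.take (2 ^ k - 1)) +
        pathTime (fun e => prof J e * w e) ((p.drop (2 ^ k - 1)).take (2 ^ k)) := by
      have : 2 ^ (k + 1) - 1 = (2 ^ k - 1) + 2 ^ k := by omega
      simp only [pathTime, SimpleGraph.Walk.darts_take, SimpleGraph.Walk.darts_drop, this,
        List.take_add, List.map_append, List.sum_append]
    rw [h5, fastCount, Finset.sum_range_succ]
    rw [fastCount] at h3
    push_cast
    linarith

lemma pathTime_mono_sublist {w : Edge → ℝ} (hw : ∀ e, 0 ≤ w e) {x y x' y' : ℤ × ℤ}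
    {p : lattice.Walk x y} {q : lattice.Walk x' y'} (h : p.darts.Sublist q.darts) :
    pathTime w p ≤ pathTime w q := by
  refine (h.map _).sum_le_sum fun a ha => ?_
  obtain ⟨d, -, rfl⟩ := List.mem_map.1 ha
  exact hw _

/-- Erasing loops only lowers the time, and yields a path, whose edges are distinct; it has at least
`nrm y` steps, enough for all `J` blocks. -/
lemma le_pathTime_prof {J : ℕ} {w : Edge → ℝ} (hw : ∀ e, 0 ≤ w e)
    {y : ℤ × ℤ} (hy : 2 ^ J ≤ nrm y + 1) (p : lattice.Walk (0, 0) y) :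
    1 / 2400 * (J - fastCount J w) ≤ pathTime (fun e => prof J e * w e) p := by
  have hw' e : 0 ≤ prof J e * w e := mul_nonneg (prof_nonneg J e) (hw e)
  have h0 := nrm_le_add_length p.bypass
  have h1 : nrm (0, 0) = 0 := rfl
  refine (le_pathTime_take le_rfl hw p.bypass p.bypass_isPath (by omega)).trans
    ((pathTime_mono_sublist hw' ?_).trans
      (pathTime_mono_sublist hw' p.darts_bypass_sublist_darts))
  rw [SimpleGraph.Walk.darts_take]
  exact List.take_sublist _ _

lemma pathTime_nonneg {w : Edge → ℝ} (hw : ∀ e, 0 ≤ w e) {x y : ℤ × ℤ} (p : lattice.Walk x y) :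
    0 ≤ pathTime w p := by
  rw [pathTime_eq]
  refine List.sum_nonneg fun a ha => ?_
  obtain ⟨e, -, rfl⟩ := List.mem_map.1 ha
  exact hw e

lemma passageTime_le {w : Edge → ℝ} (hw : ∀ e, 0 ≤ w e) {x y : ℤ × ℤ} (p : lattice.Walk x y) :
    passageTime w x y ≤ pathTime w p :=
  ciInf_le ⟨0, by rintro _ ⟨q, rfl⟩; exact pathTime_nonneg hw q⟩ p

lemma passageTime_nonneg {w : Edge → ℝ} (hw : ∀ e, 0 ≤ w e) (x y : ℤ × ℤ) :
    0 ≤ passageTime w x y := Real.iInf_nonneg fun p => pathTime_nonneg hw p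

lemma nonempty_walk_add_smul_step (x : ℤ × ℤ) (i : Fin 4) (k : ℕ) :
    Nonempty (lattice.Walk x (x + k • step i)) := by
  induction k with
  | zero => simpa using ⟨SimpleGraph.Walk.nil⟩
  | succ k ih =>
    obtain ⟨p⟩ := ih
    rw [succ_nsmul, ← add_assoc]
    exact ⟨p.concat (adj_add_step _ i)⟩

instance nonempty_walk (x y : ℤ × ℤ) : Nonempty (lattice.Walk x y) := by
  have h1 (x : ℤ × ℤ) (a : ℤ) : Nonempty (lattice.Walk x (x + (a, 0))) := by
    rcases a.natAbs_eq with h | h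
    · obtain ⟨p⟩ := nonempty_walk_add_smul_step x 0 a.natAbs
      exact ⟨p.copy rfl (by rw [h]; simp [step])⟩
    · obtain ⟨p⟩ := nonempty_walk_add_smul_step x 1 a.natAbs
      exact ⟨p.copy rfl (by rw [h]; simp [step])⟩
  have h2 (x : ℤ × ℤ) (a : ℤ) : Nonempty (lattice.Walk x (x + (0, a))) := by
    rcases a.natAbs_eq with h | h
    · obtain ⟨p⟩ := nonempty_walk_add_smul_step x 2 a.natAbs
      exact ⟨p.copy rfl (by rw [h]; simp [step])⟩
    · obtain ⟨p⟩ := nonempty_walk_add_smul_step x 3 a.natAbs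
      exact ⟨p.copy rfl (by rw [h]; simp [step])⟩
  obtain ⟨p⟩ := h1 x (y.1 - x.1)
  obtain ⟨q⟩ := h2 (x + (y.1 - x.1, 0)) (y.2 - x.2)
  exact ⟨(p.append q).copy rfl (by ext <;> simp)⟩

/-- Adding `κ` times the perturbation profile increases the passage time by a multiple
of the number of scales without fast trails. -/
lemma add_le_passageTime_perturb {J : ℕ} {w : Edge → ℝ} (hw : ∀ e, 0 ≤ w e) {y : ℤ × ℤ}
    (hy : 2 ^ J ≤ nrm y + 1) {s κ : ℝ} (hs : 0 ≤ s) (hκ : 0 ≤ κ) :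
    passageTime (fun e => (1 + s * prof J e) * w e) (0, 0) y +
      κ * (1 / 2400 * (J - fastCount J w)) ≤
      passageTime (fun e => (1 + (s + κ) * prof J e) * w e) (0, 0) y := by
  -- The gain is bounded below for every walk simultaneously, so it passes to the infimum without
  -- any geodesic.
  refine le_ciInf fun p => ?_
  have h1 : passageTime (fun e => (1 + s * prof J e) * w e) (0, 0) y ≤
      pathTime (fun e => (1 + s * prof J e) * w e) p :=
    passageTime_le (fun e => mul_nonneg (by have := prof_nonneg J e; positivity) (hw e)) p
  have h2 := mul_le_mul_of_nonneg_left (le_pathTime_prof hw hy p) hκ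
  refine (add_le_add h1 h2).trans_eq ?_
  rw [pathTime_eq, pathTime_eq, pathTime_eq, ← List.sum_map_mul_left, ← List.sum_map_add]
  congr 2
  funext e
  ring

instance countable_walk (x y : ℤ × ℤ) : Countable (lattice.Walk x y) :=
  Function.Injective.countable (f := fun p : lattice.Walk x y => p.support)
    fun _ _ h => SimpleGraph.Walk.ext_support h

lemma measurable_passageTime (x y : ℤ × ℤ) : Measurable fun w => passageTime w x y :=
  Measurable.iInf fun p => by
    simp_rw [pathTime_eq]
    exact measurable_sum_map _

end Walks

end FPP

namespace FPP

/-! ### Rarity of fast trails, and integrability. -/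

section FastTrails

open Measure

/-- Chernoff bound with parameter `1200`: each distinct edge contributes a factor `e / 1201 < 1 /
400`, small enough to beat the `4` choices per step of a walk. -/
lemma measureReal_sum_map_le {ι : Type*} {l : List ι} (hl : l.Nodup) :
    (expProd ι).real {w | (l.map w).sum ≤ 1 / 1200 * l.length} ≤ (1 / 400) ^ l.length := by
  classical
  have hle : expProd ι {w | (l.map w).sum ≤ 1 / 1200 * l.length} ≤
      ENNReal.ofReal ((1 / 400) ^ l.length) := by
    have hm : MeasurableSet {w : ι → ℝ | (l.map w).sum ≤ 1 / 1200 * l.length} := by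
      refine measurableSet_le ?_ measurable_const
      clear hl
      induction l with
      | nil => simp
      | cons e l ih =>
        simp only [List.map_cons, List.sum_cons]
        fun_prop
    rw [← lintegral_indicator_one hm]
    calc _ ≤ ∫⁻ w, ∏ e ∈ l.toFinset, ENNReal.ofReal (Real.exp (1 - 1200 * w e)) ∂(expProd ι) := by
          refine lintegral_mono fun w => ?_
          rw [← ENNReal.ofReal_prod_of_nonneg fun _ _ => (Real.exp_pos _).le, ← Real.exp_sum]
          by_cases hw : w ∈ {w : ι → ℝ | (l.map w).sum ≤ 1 / 1200 * l.length}
          swap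
          · rw [Set.indicator_of_notMem hw]
            exact zero_le
          rw [Set.indicator_of_mem hw, Pi.one_apply, ENNReal.one_le_ofReal, Real.one_le_exp_iff, Finset.sum_sub_distrib,
            ← Finset.mul_sum, Finset.sum_const, List.toFinset_card_of_nodup hl,
            List.sum_toFinset _ hl, nsmul_eq_mul, mul_one]
          have : (l.map w).sum ≤ 1 / 1200 * l.length := hw
          linarith
      _ = ∏ e ∈ l.toFinset, ∫⁻ x, ENNReal.ofReal (Real.exp (1 - 1200 * x)) ∂(expMeasure 1) :=
          lintegral_infinitePi_prod _ (g := fun _ x => ENNReal.ofReal (Real.exp (1 - 1200 * x)))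
            fun _ => by fun_prop
      _ = ENNReal.ofReal (Real.exp 1 / 1201) ^ l.length := by
          rw [Finset.prod_const, List.toFinset_card_of_nodup hl]
          have h (x : ℝ) : ENNReal.ofReal (Real.exp (1 - 1200 * x)) =
              ENNReal.ofReal (Real.exp 1) * ENNReal.ofReal (Real.exp (-1200 * x)) := by
            rw [← ENNReal.ofReal_mul (Real.exp_pos _).le, ← Real.exp_add]
            ring_nf
          simp_rw [h]
          rw [lintegral_const_mul _ (by fun_prop), lintegral_exp_mul_expMeasure (by norm_num),
            ← ENNReal.ofReal_mul (Real.exp_pos _).le]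
          norm_num [div_eq_mul_inv]
      _ = ENNReal.ofReal ((Real.exp 1 / 1201) ^ l.length) :=
          (ENNReal.ofReal_pow (by positivity) _).symm
      _ ≤ _ := by
          refine ENNReal.ofReal_le_ofReal (pow_le_pow_left₀ (by positivity) ?_ _)
          have := Real.exp_one_lt_d9
          linarith
  exact ENNReal.toReal_le_of_le_ofReal (by positivity) hle

/-- Union bound: at most `4 ^ (2 ^ j)` trails from each of at most `9 * 4 ^ j` starting points. What
remains is `(1 / 100) ^ (2 ^ j)` per point, far below the geometric bound needed for summing over
scales. -/
lemma measureReal_fastSet_le (j : ℕ) :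
    (expProd Edge).real (fastSet j) ≤ 1 / 4 * (1 / 2) ^ j := by
  have hl {x : ℤ × ℤ} {l : List Edge} (h : l ∈ (edgeLists (2 ^ j) x).filter List.Nodup) :
      (expProd Edge).real {w | (l.map w).sum ≤ 1 / 1200 * 2 ^ j} ≤ (1 / 400) ^ 2 ^ j := by
    rw [Finset.mem_filter] at h
    have h1 := length_of_mem_edgeLists h.1
    have h2 := measureReal_sum_map_le h.2
    rw [h1] at h2
    exact_mod_cast h2
  have hx (x : ℤ × ℤ) : (expProd Edge).real (⋃ l ∈ (edgeLists (2 ^ j) x).filter List.Nodup,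
      {w | (l.map w).sum ≤ 1 / 1200 * 2 ^ j}) ≤ (1 / 100) ^ 2 ^ j := by
    refine (measureReal_biUnion_finset_le _ _).trans
      ((Finset.sum_le_sum fun l h => hl h).trans ?_)
    rw [Finset.sum_const, nsmul_eq_mul]
    have h1 : (((edgeLists (2 ^ j) x).filter List.Nodup).card : ℝ) ≤ 4 ^ 2 ^ j := by
      exact_mod_cast (Finset.card_filter_le _ _).trans (card_edgeLists_le _ _)
    refine (mul_le_mul_of_nonneg_right h1 (by positivity)).trans_eq ?_
    rw [← mul_pow]
    norm_num
  refine (measureReal_biUnion_finset_le _ _).trans ((Finset.sum_le_sum fun x _ => hx x).trans ?_)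
  rw [Finset.sum_const, nsmul_eq_mul, card_box]
  have h1 : (1 : ℝ) ≤ 2 ^ j := one_le_pow₀ one_le_two
  have h2 : (((2 * 2 ^ j + 1) ^ 2 : ℕ) : ℝ) ≤ 9 * 4 ^ j := by
    have : (4 : ℝ) ^ j = 2 ^ j * 2 ^ j := by rw [← mul_pow]; norm_num
    rw [this]
    push_cast
    nlinarith
  have h3 : (1 / 100 : ℝ) ^ 2 ^ j ≤ (1 / 100) ^ (j + 1) :=
    pow_le_pow_of_le_one (by norm_num) (by norm_num) Nat.lt_two_pow_self
  calc _ ≤ (9 * 4 ^ j) * (1 / 100 : ℝ) ^ (j + 1) :=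
        mul_le_mul h2 h3 (by positivity) (by positivity)
    _ = 9 / 100 * (1 / 25) ^ j := by
        rw [pow_succ, show (1 / 25 : ℝ) = 4 * (1 / 100) by norm_num, mul_pow]; ring
    _ ≤ 1 / 4 * (1 / 2) ^ j :=
        mul_le_mul (by norm_num) (pow_le_pow_left₀ (by norm_num) (by norm_num) j)
          (by positivity) (by norm_num)

lemma fastCount_nonneg (J : ℕ) (w : Edge → ℝ) : 0 ≤ fastCount J w :=
  Finset.sum_nonneg fun _ _ => Set.indicator_nonneg (fun _ _ => zero_le_one) _

lemma measurable_fastCount (J : ℕ) : Measurable (fastCount J) :=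
  Finset.measurable_fun_sum _ fun j _ => measurable_one.indicator (measurableSet_fastSet j)

lemma integrable_fastCount (J : ℕ) : Integrable (fastCount J) (expProd Edge) :=
  integrable_finsetSum _ fun j _ => (integrable_const (1 : ℝ)).indicator (measurableSet_fastSet j)

lemma integral_fastCount_le (J : ℕ) : ∫ w, fastCount J w ∂(expProd Edge) ≤ 1 / 2 := by
  unfold fastCount
  rw [integral_finsetSum (f := fun j => (fastSet j).indicator 1) _ fun j _ =>
    (integrable_const (1 : ℝ)).indicator (measurableSet_fastSet j)]
  simp_rw [integral_indicator_one (measurableSet_fastSet _)]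
  refine (Finset.sum_le_sum fun j _ => measureReal_fastSet_le j).trans ?_
  rw [← Finset.mul_sum]
  have h := (summable_geometric_two).sum_le_tsum (Finset.range J) fun j _ => by positivity
  rw [tsum_geometric_two] at h
  linarith

/-- Markov's inequality, using that the mean is at most `1 / 2` whatever `J` is. -/
lemma measureReal_half_le_fastCount {J : ℕ} (hJ : 0 < J) :
    (expProd Edge).real {w | (J : ℝ) / 2 ≤ fastCount J w} ≤ 1 / J := by
  have hJ' : (0 : ℝ) < J := by exact_mod_cast hJ
  have h := mul_meas_ge_le_integral_of_nonneg (ae_of_all _ (fastCount_nonneg J))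
    (integrable_fastCount J) ((J : ℝ) / 2)
  rw [le_div_iff₀ hJ']
  have := integral_fastCount_le J
  change (J : ℝ) / 2 * (expProd Edge).real {w | (J : ℝ) / 2 ≤ fastCount J w} ≤ _ at h
  linarith

lemma ae_nonneg_expProd {ι : Type*} [Countable ι] : ∀ᵐ w ∂(expProd ι), ∀ i, 0 ≤ w i := by
  rw [ae_all_iff]
  intro i
  have h : ∀ᵐ x ∂(expMeasure 1), 0 ≤ x := by
    have : expMeasure 1 = volume.withDensity (exponentialPDF 1) := rfl
    rw [this, ae_withDensity_iff (f := exponentialPDF 1)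
      (measurable_exponentialPDFReal 1).ennreal_ofReal]
    refine ae_of_all _ fun x hx => ?_
    by_contra! h
    exact hx (exponentialPDF_of_neg h)
  exact (measurePreserving_eval_infinitePi (fun _ : ι => expMeasure 1) i).quasiMeasurePreserving.ae h

lemma memLp_id_expMeasure : MemLp id 2 (expMeasure 1) := by
  have hexp : Integrable (fun x => Real.exp (1 / 2 * x)) (expMeasure 1) := by
    refine ⟨by fun_prop, ?_⟩
    rw [hasFiniteIntegral_iff_ofReal (ae_of_all _ fun _ => (Real.exp_pos _).le),
      lintegral_exp_mul_expMeasure (by norm_num)]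
    exact ENNReal.ofReal_lt_top
  have hexp' : Integrable (fun x => Real.exp (-(1 / 2) * x)) (expMeasure 1) := by
    refine ⟨by fun_prop, ?_⟩
    rw [hasFiniteIntegral_iff_ofReal (ae_of_all _ fun _ => (Real.exp_pos _).le),
      lintegral_exp_mul_expMeasure (by norm_num)]
    exact ENNReal.ofReal_lt_top
  rw [memLp_two_iff_integrable_sq (by fun_prop)]
  exact integrable_pow_of_integrable_exp_mul (by norm_num) hexp hexp' 2

/-- The infimum is dominated by the time of one fixed walk, a finite sum of square-integrable terms.
-/
lemma memLp_passageTime_mul {g : Edge → ℝ} (hg : ∀ e, 0 ≤ g e) (y : ℤ × ℤ) :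
    MemLp (fun w => passageTime (fun e => g e * w e) (0, 0) y) 2 (expProd Edge) := by
  obtain ⟨p⟩ := nonempty_walk (0, 0) y
  have hp : MemLp (fun w : Edge → ℝ => pathTime (fun e => g e * w e) p) 2 (expProd Edge) := by
    simp_rw [pathTime_eq]
    induction edgeList p with
    | nil => simp
    | cons e l ih =>
      simp only [List.map_cons, List.sum_cons]
      exact ((memLp_id_expMeasure.comp_measurePreserving
        (measurePreserving_eval_infinitePi (fun _ : Edge => expMeasure 1) e)).const_mul
          (g e)).add ih
  refine hp.mono ((measurable_passageTime _ _).comp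
    (measurable_pi_lambda _ fun e => by fun_prop)).aestronglyMeasurable ?_
  filter_upwards [ae_nonneg_expProd] with w hw
  have hw' e : 0 ≤ g e * w e := mul_nonneg (hg e) (hw e)
  rw [Real.norm_of_nonneg (passageTime_nonneg hw' _ _),
    Real.norm_of_nonneg (pathTime_nonneg hw' _)]
  exact passageTime_le hw' p

lemma memLp_passageTime (y : ℤ × ℤ) :
    MemLp (fun w => passageTime w (0, 0) y) 2 (expProd Edge) := by
  simpa using memLp_passageTime_mul (g := fun _ => 1) (fun _ => zero_le_one) y

end FastTrails

end FPP

namespace FPP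

/-! ### Variance lower bound and anti-concentration. -/

section Fluctuations

lemma sq_integral_perturb_sub_le (J : ℕ) {κ : ℝ} (h0 : 0 ≤ κ) (h1 : κ ≤ 1 / 4)
    {f : (Edge → ℝ) → ℝ} (hf : Measurable f) (hf2 : MemLp f 2 (expProd Edge)) :
    (∫ w, f (fun e => (1 + κ * prof J e) * w e) ∂(expProd Edge) - ∫ w, f w ∂(expProd Edge)) ^ 2 ≤
      (Real.exp (200 * κ ^ 2 * (J + 1)) - 1) * variance f (expProd Edge) := by
  refine (sq_integral_comp_scale_sub_le (edgeBox J) (η := fun e => κ * prof J e)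
    (fun e => mul_nonneg h0 (prof_nonneg J e))
    (fun e => (mul_le_of_le_one_right h0 (prof_le_one J e)).trans h1)
    (fun e he => by rw [prof_eq_zero he, mul_zero]) hf hf2).trans ?_
  refine mul_le_mul_of_nonneg_right (sub_le_sub_right (Real.exp_le_exp.2 ?_) _)
    (variance_nonneg _ _)
  simp_rw [mul_pow, ← Finset.mul_sum]
  have := mul_le_mul_of_nonneg_left (sum_prof_sq_le J) (sq_nonneg κ)
  linarith

lemma le_variance_passageTime {J : ℕ} (hJ : 0 < J) {y : ℤ × ℤ} (hy : 2 ^ J ≤ nrm y + 1) :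
    1 / (2 * 96000 ^ 2) * (J : ℝ) ≤
      variance (fun w => passageTime w (0, 0) y) (expProd Edge) := by
  have hJ1 : (1 : ℝ) ≤ J := by exact_mod_cast hJ
  have hs : 1 ≤ √(J : ℝ) := Real.one_le_sqrt.2 hJ1
  have hs2 : √(J : ℝ) ^ 2 = J := Real.sq_sqrt (by linarith)
  -- Chosen so that `200 * κ ^ 2 * (J + 1) ≤ 1`, using `J + 1 ≤ 2 * J`.
  set κ : ℝ := 1 / (20 * √J) with hκ
  have hκ0 : 0 ≤ κ := by positivity
  have hκ1 : κ ≤ 1 / 4 := by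
    rw [hκ, div_le_div_iff₀ (by positivity) (by norm_num)]
    linarith
  have hκ2 : κ ^ 2 * J = 1 / 400 := by
    rw [hκ, div_pow, mul_pow, hs2]; field_simp; norm_num
  have hm := memLp_passageTime y
  have hm' := memLp_passageTime_mul (g := fun e => 1 + κ * prof J e)
    (fun e => by have := prof_nonneg J e; positivity) y
  have hgain : Integrable (fun w => κ * (1 / 2400 * (J - fastCount J w))) (expProd Edge) :=
    (((integrable_const _).sub (integrable_fastCount J)).const_mul _).const_mul _
  have h1 := sq_integral_perturb_sub_le J hκ0 hκ1 (measurable_passageTime (0, 0) y) hm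
  -- On average at least `J / 2` scales have no fast trail, so the mean rises by at least `κ * J /
  -- 4800`.
  have h2 : √J / 96000 ≤
      ∫ w, passageTime (fun e => (1 + κ * prof J e) * w e) (0, 0) y ∂(expProd Edge) -
        ∫ w, passageTime w (0, 0) y ∂(expProd Edge) := by
    have h3 : ∫ w, (passageTime w (0, 0) y + κ * (1 / 2400 * (J - fastCount J w))) ∂(expProd Edge)
        ≤ ∫ w, passageTime (fun e => (1 + κ * prof J e) * w e) (0, 0) y ∂(expProd Edge) := by
      refine integral_mono_ae ((hm.integrable one_le_two).add hgain) (hm'.integrable one_le_two) ?_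
      filter_upwards [ae_nonneg_expProd] with w hw
      simpa using add_le_passageTime_perturb hw hy le_rfl hκ0
    rw [integral_add (hm.integrable one_le_two) hgain, integral_const_mul, integral_const_mul, integral_sub (integrable_const _)
      (integrable_fastCount J)] at h3
    simp only [integral_const, probReal_univ, one_smul] at h3
    have h4 := integral_fastCount_le J
    have h5 : κ * (1 / 2400 * (J / 2)) ≤
        κ * (1 / 2400 * (J - ∫ w, fastCount J w ∂(expProd Edge))) := by
      refine mul_le_mul_of_nonneg_left ?_ hκ0
      linarith
    have h6 : κ * (1 / 2400 * (J / 2)) = √J / 96000 := by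
      rw [hκ, ← hs2, Real.sqrt_sq (by positivity)]; field_simp; norm_num
    linarith
  have h7 : Real.exp (200 * κ ^ 2 * (J + 1)) - 1 ≤ 2 := by
    have h8 : Real.exp (200 * κ ^ 2 * (J + 1)) ≤ Real.exp 1 := by
      refine Real.exp_le_exp.2 ?_
      have : κ ^ 2 * 1 ≤ κ ^ 2 * J := by gcongr
      linarith
    have := Real.exp_one_lt_d9
    linarith
  have h9 := mul_le_mul_of_nonneg_right h7
    (variance_nonneg (fun w => passageTime w (0, 0) y) (expProd Edge))
  have h10 := pow_le_pow_left₀ (by positivity) h2 2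
  rw [div_pow, hs2] at h10
  have h11 := h10.trans (h1.trans h9)
  linarith

/-- Count the indices `i < m` for which the configuration rescaled by `i * κ` hits the interval. The
expected count is at least `m * (P(S) - ε)`, while the count is at most one unless half of the
scales are fast. -/
lemma measureReal_passageTime_mem_Icc_le {J : ℕ} (hJ : 0 < J) {y : ℤ × ℤ}
    (hy : 2 ^ J ≤ nrm y + 1) {ε : ℝ} (hε : 0 < ε) (hε1 : ε ≤ 1) {m : ℕ} (hm : 0 < m)
    {a b : ℝ} (hab : b - a < ε * √J / (96000 * m)) :
    (expProd Edge).real {w | passageTime w (0, 0) y ∈ Set.Icc a b} ≤ ε + 1 / m + 1 / J := by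
  have hJ1 : (1 : ℝ) ≤ J := by exact_mod_cast hJ
  have hm0 : (0 : ℝ) < m := by exact_mod_cast hm
  have hs : 1 ≤ √(J : ℝ) := Real.one_le_sqrt.2 hJ1
  have hs2 : √(J : ℝ) ^ 2 = J := Real.sq_sqrt (by linarith)
  set κ : ℝ := ε / (20 * m * √J) with hκ
  have hκ0 : 0 < κ := by positivity
  set S : Set (Edge → ℝ) := {w | passageTime w (0, 0) y ∈ Set.Icc a b} with hS
  have hSm : MeasurableSet S := measurable_passageTime _ _ measurableSet_Icc
  set f : (Edge → ℝ) → ℝ := S.indicator 1 with hf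
  have hfm : Measurable f := measurable_one.indicator hSm
  have hf01 w : f w ∈ Set.Icc (0 : ℝ) 1 := by
    by_cases h : w ∈ S <;> simp [hf, h]
  have hf2 : MemLp f 2 (expProd Edge) :=
    memLp_of_bounded (ae_of_all _ hf01) hfm.aestronglyMeasurable 2
  let σ : ℕ → (Edge → ℝ) → Edge → ℝ := fun i w e => (1 + i * κ * prof J e) * w e
  have hσ i : Measurable (σ i) := measurable_pi_lambda _ fun e => by fun_prop
  have hσf i : Integrable (fun w => f (σ i w)) (expProd Edge) :=
    (memLp_of_bounded (ae_of_all _ fun w => hf01 (σ i w))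
      (hfm.comp (hσ i)).aestronglyMeasurable 1).integrable le_rfl
  have hfint : ∫ w, f w ∂(expProd Edge) = (expProd Edge).real S := integral_indicator_one hSm
  have htv i (hi : i ∈ Finset.range m) :
      (expProd Edge).real S - ε ≤ ∫ w, f (σ i w) ∂(expProd Edge) := by
    have hi' : (i : ℝ) ≤ m := by exact_mod_cast (Finset.mem_range.1 hi).le
    have h1 : i * κ ≤ ε / (20 * √J) := by
      calc i * κ ≤ m * κ := by gcongr
        _ = _ := by rw [hκ]; field_simp
    have h2 : i * κ ≤ 1 / 4 := by
      refine h1.trans ?_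
      rw [div_le_div_iff₀ (by positivity) (by norm_num)]
      linarith
    have h3 := sq_integral_perturb_sub_le J (by positivity) h2 hfm hf2
    -- From `exp x - 1 ≤ 2 * x` on `[0, 1]`. An indicator has variance at most `1 / 4`, so the shift
    -- in probability is below `ε`.
    have h4 : Real.exp (200 * (i * κ) ^ 2 * (J + 1)) - 1 ≤ 2 * ε ^ 2 := by
      have h5 : (i * κ) ^ 2 * J ≤ ε ^ 2 / 400 := by
        calc (i * κ) ^ 2 * J ≤ (ε / (20 * √J)) ^ 2 * J := by gcongr
          _ = ε ^ 2 / 400 := by rw [div_pow, mul_pow, hs2]; field_simp; norm_num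
      have h6 : 200 * (i * κ) ^ 2 * (J + 1) ≤ ε ^ 2 := by
        have : (i * κ) ^ 2 * 1 ≤ (i * κ) ^ 2 * J := by gcongr
        linarith
      have h7 : ε ^ 2 ≤ 1 := pow_le_one₀ hε.le hε1
      have h8 := Real.abs_exp_sub_one_le (x := ε ^ 2) (by rwa [abs_of_nonneg (sq_nonneg ε)])
      rw [abs_of_nonneg (sq_nonneg ε)] at h8
      have := Real.exp_le_exp.2 h6
      linarith [le_abs_self (Real.exp (ε ^ 2) - 1)]
    have h9 := variance_le_sq_of_bounded (ae_of_all (expProd Edge) hf01) hfm.aemeasurable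
    have h10 : (∫ w, f (σ i w) ∂(expProd Edge) - ∫ w, f w ∂(expProd Edge)) ^ 2 ≤ ε ^ 2 := by
      refine h3.trans ((mul_le_mul h4 h9 (variance_nonneg _ _) (by positivity)).trans ?_)
      nlinarith [sq_nonneg ε]
    rw [← hfint]
    linarith [(abs_le.1 (abs_le_of_sq_le_sq h10 hε.le)).1]
  set B : Set (Edge → ℝ) := {w | (J : ℝ) / 2 ≤ fastCount J w} with hB
  have hBm : MeasurableSet B := measurableSet_le measurable_const (measurable_fastCount J)
  have hpt : ∀ᵐ w ∂(expProd Edge),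
      ∑ i ∈ Finset.range m, f (σ i w) ≤ 1 + m * B.indicator 1 w := by
    filter_upwards [ae_nonneg_expProd] with w hw
    by_cases hwB : w ∈ B
    · refine (Finset.sum_le_sum fun i _ => (hf01 (σ i w)).2).trans ?_
      simp [hwB]
    · rw [Set.indicator_of_notMem hwB, mul_zero, add_zero]
      have hlt : fastCount J w < J / 2 := not_le.1 hwB
      -- Between two indices the passage time grows by at least `κ * J / 4800`, which equals the
      -- strict upper bound imposed on `b - a`.
      have hsep {i j : ℕ} (hij : i < j) (hi : σ i w ∈ S) (hj : σ j w ∈ S) : False := by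
        have hij' : (1 : ℝ) ≤ (j : ℝ) - i := by
          have : (i : ℝ) + 1 ≤ j := by exact_mod_cast hij
          linarith
        have h1 := add_le_passageTime_perturb hw hy (s := i * κ) (κ := (j - i) * κ)
          (by positivity) (by positivity)
        have h2 : (i : ℝ) * κ + (j - i) * κ = j * κ := by ring
        rw [h2] at h1
        have h3 : ε * √J / (96000 * m) ≤
            (j - i) * κ * (1 / 2400 * (J - fastCount J w)) := by
          calc ε * √J / (96000 * m) = 1 * κ * (1 / 2400 * (J / 2)) := by
                rw [hκ, ← hs2, Real.sqrt_sq (by positivity)]; field_simp; norm_num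
            _ ≤ _ := by
                have : (J : ℝ) / 2 ≤ J - fastCount J w := by linarith
                gcongr
        have hi' : a ≤ passageTime (fun e => (1 + i * κ * prof J e) * w e) (0, 0) y := hi.1
        have hj' : passageTime (fun e => (1 + j * κ * prof J e) * w e) (0, 0) y ≤ b := hj.2
        linarith
      simp only [hf, Set.indicator_apply, Pi.one_apply, Finset.sum_boole]
      have : ((Finset.range m).filter fun i => σ i w ∈ S).card ≤ 1 := by
        refine Finset.card_le_one.2 fun i hi j hj => ?_
        rw [Finset.mem_filter] at hi hj
        rcases lt_trichotomy i j with h | h | h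
        · exact (hsep h hi.2 hj.2).elim
        · exact h
        · exact (hsep h hj.2 hi.2).elim
      exact_mod_cast this
  have hBi : Integrable (B.indicator (1 : (Edge → ℝ) → ℝ)) (expProd Edge) :=
    (integrable_const (1 : ℝ)).indicator hBm
  have hsum := integral_mono_ae (integrable_finsetSum _ fun i _ => hσf i)
    ((integrable_const (1 : ℝ)).add (hBi.const_mul (m : ℝ))) hpt
  rw [integral_finsetSum _ fun i _ => hσf i] at hsum
  simp only [Pi.add_apply] at hsum
  rw [integral_add (integrable_const _) (hBi.const_mul _), integral_const_mul,
    integral_indicator_one hBm] at hsum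
  simp only [integral_const, probReal_univ, one_smul] at hsum
  have h1 := (Finset.sum_le_sum htv).trans hsum
  rw [Finset.sum_const, Finset.card_range, nsmul_eq_mul] at h1
  have h2 := mul_le_mul_of_nonneg_left (measureReal_half_le_fastCount hJ) hm0.le
  have h3 : m * ((expProd Edge).real S - ε) ≤ m * (1 / m + 1 / J) := by
    rw [mul_add, mul_one_div_cancel hm0.ne']
    exact h1.trans (add_le_add_right h2 1)
  linarith [le_of_mul_le_mul_left h3 hm0]

/-- The `ℓ¹`-norm dominates the Euclidean one and each floor loses less than one. The bound is
uniform in the direction, hence so is the final constant. -/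
lemma le_nrm_intPart {v : EuclideanSpace ℝ (Fin 2)} (hv : ‖v‖ = 1) (n : ℕ) :
    n ≤ nrm (intPart v n) + 1 := by
  have h1 : 1 ≤ |v 0| + |v 1| := by
    have h := EuclideanSpace.norm_sq_eq v
    rw [hv, Fin.sum_univ_two, Real.norm_eq_abs, Real.norm_eq_abs] at h
    nlinarith [abs_nonneg (v 0), abs_nonneg (v 1)]
  have h2 (a : ℝ) : |a| - 1 < (⌊a⌋.natAbs : ℝ) := by
    rw [Nat.cast_natAbs, Int.cast_abs]
    rcases le_or_gt 0 a with h | h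
    · rw [abs_of_nonneg h]
      linarith [Int.lt_floor_add_one a, le_abs_self (⌊a⌋ : ℝ)]
    · rw [abs_of_neg h]
      linarith [Int.floor_le a, neg_le_abs (⌊a⌋ : ℝ)]
  have h3 : (n : ℝ) < nrm (intPart v n) + 2 := by
    have h4 := h2 (n * v 0)
    have h5 := h2 (n * v 1)
    rw [abs_mul, Nat.abs_cast] at h4 h5
    have h6 := mul_le_mul_of_nonneg_left h1 (Nat.cast_nonneg (α := ℝ) n)
    simp only [nrm, intPart]
    push_cast at h4 h5 ⊢
    linarith
  have : n < nrm (intPart v n) + 2 := by exact_mod_cast h3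
  omega

lemma log_le_two_mul_log_two {n : ℕ} (hn : 2 ≤ n) : Real.log n ≤ 2 * Nat.log 2 n := by
  have h1 : n < 2 ^ (Nat.log 2 n + 1) := Nat.lt_pow_succ_log_self one_lt_two n
  have h2 : 1 ≤ Nat.log 2 n := Nat.log_pos one_lt_two hn
  have h3 : Real.log n ≤ (Nat.log 2 n + 1) * Real.log 2 := by
    calc Real.log n ≤ Real.log ((2 : ℝ) ^ (Nat.log 2 n + 1)) :=
          Real.log_le_log (by positivity) (by exact_mod_cast h1.le)
      _ = _ := by rw [Real.log_pow]; push_cast; ring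
  have h4 : (1 : ℝ) ≤ Nat.log 2 n := by exact_mod_cast h2
  have := Real.log_two_lt_d9
  nlinarith

lemma two_pow_log_le_nrm {v : EuclideanSpace ℝ (Fin 2)} (hv : ‖v‖ = 1) {n : ℕ} (hn : n ≠ 0) :
    2 ^ Nat.log 2 n ≤ nrm (intPart v n) + 1 :=
  (Nat.pow_log_le_self 2 hn).trans (le_nrm_intPart hv n)

lemma tendsto_measureReal_passageTime_mem_Icc {v : EuclideanSpace ℝ (Fin 2)} (hv : ‖v‖ = 1)
    {a b : ℕ → ℝ} (hab : (fun n => b n - a n) =o[atTop] fun n : ℕ => √(Real.log n)) :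
    Tendsto (fun n => (expProd Edge).real
      {w | passageTime w (0, 0) (intPart v n) ∈ Set.Icc (a n) (b n)}) atTop (𝓝 0) := by
  rw [Metric.tendsto_atTop']
  intro δ hδ
  -- The three error terms `ε`, `1 / m` and `1 / J` each receive `δ / 4`.
  set ε : ℝ := min 1 (δ / 4) with hε
  have hε0 : 0 < ε := by positivity
  obtain ⟨m, hm⟩ := exists_nat_one_div_lt (show 0 < δ / 4 by positivity)
  have hm' : 1 / ((m + 1 : ℕ) : ℝ) < δ / 4 := by push_cast; exact hm
  obtain ⟨J₀, hJ₀⟩ := exists_nat_one_div_lt (show 0 < δ / 4 by positivity)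
  -- Of the factor `4`, one `2` absorbs `√(log n) ≤ 2 * √J` and the other makes the inequality
  -- strict.
  have hc : 0 < ε / (96000 * (m + 1 : ℕ)) / 4 := by positivity
  have h := (hab.def hc).and (eventually_ge_atTop (2 ^ (J₀ + 1)))
  obtain ⟨N, hN⟩ := eventually_atTop.1 h
  refine ⟨N, fun n hn => ?_⟩
  obtain ⟨h1, h2⟩ := hN n hn.le
  have hn2 : 2 ≤ n := le_trans (by rw [pow_succ]; have := Nat.one_le_two_pow (n := J₀); omega) h2
  set J := Nat.log 2 n with hJ
  have hJJ : J₀ + 1 ≤ J := Nat.le_log_of_pow_le one_lt_two h2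
  have hJ1 : (J₀ : ℝ) + 1 ≤ J := by exact_mod_cast hJJ
  have hJpos : (0 : ℝ) < J := by exact_mod_cast (show 0 < J by omega)
  have hsJ : 0 < √(J : ℝ) := Real.sqrt_pos.2 hJpos
  have h3 : √(Real.log n) ≤ 2 * √J := by
    rw [← Real.sqrt_sq (show (0 : ℝ) ≤ 2 by norm_num), ← Real.sqrt_mul (by norm_num)]
    refine Real.sqrt_le_sqrt ?_
    linarith [log_le_two_mul_log_two hn2]
  rw [Real.norm_eq_abs, Real.norm_of_nonneg (Real.sqrt_nonneg _)] at h1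
  have h4 : b n - a n < ε * √J / (96000 * (m + 1 : ℕ)) := by
    calc b n - a n ≤ _ := (le_abs_self _).trans h1
      _ ≤ ε / (96000 * (m + 1 : ℕ)) / 4 * (2 * √J) := by gcongr
      _ = (ε * √J / (96000 * (m + 1 : ℕ))) / 2 := by ring
      _ < _ := half_lt_self (by positivity)
  have h5 := measureReal_passageTime_mem_Icc_le (by omega) (two_pow_log_le_nrm hv (by omega)) hε0
    (min_le_left _ _) (Nat.succ_pos m) h4
  have h6 : 1 / (J : ℝ) ≤ 1 / (J₀ + 1) := by gcongr
  rw [dist_zero_right, Real.norm_of_nonneg measureReal_nonneg]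
  have h7 : ε ≤ δ / 4 := min_le_right _ _
  change _ ≤ ε + 1 / ((m + 1 : ℕ) : ℝ) + 1 / (J : ℝ) at h5
  linarith

end Fluctuations

end FPP

theorem theorem1 :
    ∃ C : ℝ, 0 < C ∧
      ∀ (Ω : Type*) [MeasurableSpace Ω] (P : Measure Ω) [IsProbabilityMeasure P]
        (τ : FPP.Edge → Ω → ℝ),
        iIndepFun τ P → (∀ e, HasLaw (τ e) (expMeasure 1) P) →
        ∀ v : EuclideanSpace ℝ (Fin 2), ‖v‖ = 1 →
          (∀ n : ℕ, 1 ≤ n →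
            MemLp (fun ω => FPP.passageTime (fun e => τ e ω) (0, 0) (FPP.intPart v n)) 2 P ∧
            C * Real.log n ≤
              variance (fun ω => FPP.passageTime (fun e => τ e ω) (0, 0) (FPP.intPart v n)) P) ∧
          (∀ a b : ℕ → ℝ,
            (fun n => b n - a n) =o[atTop] (fun n : ℕ => Real.sqrt (Real.log n)) →
            Tendsto
              (fun n => P {ω | FPP.passageTime (fun e => τ e ω) (0, 0) (FPP.intPart v n) ∈
                Set.Icc (a n) (b n)})
              atTop (𝓝 0)) := by
  -- Half the constant of `le_variance_passageTime`, because `log n ≤ 2 * Nat.log 2 n`.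
  refine ⟨1 / (4 * 96000 ^ 2), by positivity, fun Ω _ P _ τ hτ hlaw v hv => ?_⟩
  -- All claims depend only on the joint law of the passage times, which independence identifies
  -- with the product measure.
  have hY : HasLaw (fun ω e => τ e ω) (FPP.expProd FPP.Edge) P :=
    hτ.hasLaw_infinitePi hlaw (aemeasurable_pi_iff.2 fun e => (hlaw e).aemeasurable)
  refine ⟨fun n hn => ⟨?_, ?_⟩, fun a b hab => ?_⟩
  · have h := FPP.memLp_passageTime (FPP.intPart v n)
    rw [← hY.map_eq, memLp_map_measure_iff
      (FPP.measurable_passageTime _ _).aestronglyMeasurable hY.aemeasurable] at h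
    exact h
  · have h : variance (fun ω => FPP.passageTime (fun e => τ e ω) (0, 0) (FPP.intPart v n)) P =
        variance (fun w => FPP.passageTime w (0, 0) (FPP.intPart v n)) (FPP.expProd FPP.Edge) := by
      rw [← hY.map_eq, variance_map (FPP.measurable_passageTime _ _).aemeasurable hY.aemeasurable]
      rfl
    rw [h]
    rcases hn.eq_or_lt with rfl | hn
    -- At `n = 1` the logarithm vanishes.
    · simp [variance_nonneg]
    · have h1 := FPP.le_variance_passageTime (Nat.log_pos one_lt_two hn)
        (FPP.two_pow_log_le_nrm hv (n := n) (by omega))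
      have h2 := FPP.log_le_two_mul_log_two hn
      refine le_trans ?_ h1
      linarith
  · have h := FPP.tendsto_measureReal_passageTime_mem_Icc hv hab
    rw [← ENNReal.tendsto_toReal_iff (fun n => measure_ne_top _ _) ENNReal.zero_ne_top]
    refine h.congr fun n => ?_
    exact congrArg ENNReal.toReal
      (hY.measure_eq (FPP.measurable_passageTime _ _ measurableSet_Icc)).symm
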